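/- Let $D$ be an integral domain with quotient field $K$, and let $\overline{\boldsymbol F}(D)$ be the set of nonzero $D$-submodules of $K$; likewise $\overline{\boldsymbol F}(D[X])$ is the set of nonzero $D[X]$-submodules of $K(X)$. A *semistar operation* of $D$ is a map $\star:\overline{\boldsymbol F}(D)\to\overline{\boldsymbol F}(D)$, $E\mapsto E^\star$, such that for all $0\ne x\in K$ and all $E,F$: $(xE)^\star=xE^\star$; $E\subseteq F$ implies $E^\star\subseteq F^\star$; $E\subseteq E^\star$ and $(E^\star)^\star=E^\star$. Semistar operations of $D[X]$ are defined in the same way, and $\star_1\le\star_2$ means $E^{\star_1}\subseteq E^{\star_2}$ for all $E$. Put $E^{\star_f}:=\bigcup\{F^\star : 0\ne F\subseteq E,\ F \text{ a finitely generated } D\text{-submodule}\}$. Let $\operatorname{QMax}^{\star_f}(D)$ be the set of ideals of $D$ that are maximal among the proper nonzero ideals $I$ with $I^{\star_f}\cap D=I$ (they are prime), and put $E^{\tilde\star}:=\bigcap\{ED_Q : Q\in\operatorname{QMax}^{\star_f}(D)\}$ (with $E^{\tilde\star}=K$ if $\operatorname{QMax}^{\star_f}(D)=\emptyset$). For a semistar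 operation $\ast$ of $D$, a semistar operation $\bigstar$ of $D[X]$ is an *extension* of $\ast$ if $E^{\ast}=(E[X])^{\bigstar}\cap K$, and a *strict extension* if $E^{\ast}[X]=(E[X])^{\bigstar}$, for all $E\in\overline{\boldsymbol F}(D)$. Let $\curlywedge^{\ast}$ be the infimum of all extensions of $\ast$ to $D[X]$, i.e. $A^{\curlywedge^{\ast}}:=\bigcap\{A^{\bigstar} : \bigstar \text{ is an extension of } \ast\}$. **Theorem.** Let $\star$ be a semistar operation of $D$. Then $\curlywedge^{\tilde\star}$ is the smallest strict extension of $\tilde\star$ to $D[X]$. If $\operatorname{QMax}^{\star_f}(D)\neq\emptyset$, it equals the semistar operation $[\tilde\star]$, i.e. $$A^{\curlywedge^{\tilde\star}}=A^{[\tilde\star]}:=\bigcap\{AD_Q[X] : Q\in\operatorname{QMax}^{\star_f}(D)\}\qquad\text{for all } A\in\overline{\boldsymbol F}(D[X]).$$ If $\operatorname{QMax}^{\star_f}(D)=\emptyset$, then $A^{\curlywedge^{\tilde\star}}=AK[X]$ for all $A\in\overline{\boldsymbol F}(D[X])$. -/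

import Mathlib

open Polynomial Pointwise

set_option linter.unusedSectionVars false

namespace Semistar

/-- The set of all nonzero `R`-submodules of a field `F` containing `R`
(used when `F` is the quotient field of the domain `R`). -/
abbrev Fbar (R F : Type*) [CommRing R] [Field F] [Algebra R F] : Type _ :=
  {E : Submodule R F // E ≠ ⊥}

/-- The submodule `xE`, for a nonzero `x` in `F`. -/
noncomputable def Fbar.scale {R F : Type*} [CommRing R] [Field F] [Algebra R F]
    (x : F) (hx : x ≠ 0) (E : Fbar R F) : Fbar R F :=
  ⟨x • E.1, fun h => E.2 (by
    rw [← inv_smul_smul₀ hx E.1, h, Submodule.smul_bot'])⟩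

/-- A semistar operation of an integral domain `R` with quotient field `F`. -/
@[ext]
structure SemistarOp (R F : Type*) [CommRing R] [IsDomain R] [Field F] [Algebra R F]
    [IsFractionRing R F] where
  /-- The underlying map on nonzero `R`-submodules of `F`. -/
  op : Fbar R F → Fbar R F
  op_scale : ∀ (x : F) (hx : x ≠ 0) (E : Fbar R F), op (E.scale x hx) = (op E).scale x hx
  op_mono : ∀ E G : Fbar R F, E ≤ G → op E ≤ op G
  le_op : ∀ E : Fbar R F, E ≤ op E
  op_op : ∀ E : Fbar R F, op (op E) = op E

section General

variable {R F : Type*} [CommRing R] [IsDomain R] [Field F] [Algebra R F] [IsFractionRing R F]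

/-- `s ≤ t` means that `E^s ⊆ E^t` for every nonzero submodule `E` of the quotient field. -/
instance : PartialOrder (SemistarOp R F) where
  le s t := ∀ E, s.op E ≤ t.op E
  le_refl _ _ := le_refl _
  le_trans _ _ _ h₁ h₂ E := (h₁ E).trans (h₂ E)
  le_antisymm _ _ h₁ h₂ := SemistarOp.ext (funext fun E => le_antisymm (h₁ E) (h₂ E))

theorem ne_bot_of_le {E G : Submodule R F} (hE : E ≠ ⊥) (h : E ≤ G) : G ≠ ⊥ :=
  fun h0 => hE (le_bot_iff.1 (h0 ▸ h))

theorem mem_scale {x : F} (hx : x ≠ 0) {E : Fbar R F} {y : F} :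
    y ∈ (E.scale x hx).1 ↔ x⁻¹ * y ∈ E.1 := by
  change y ∈ x • E.1 ↔ _
  rw [Submodule.mem_smul_pointwise_iff_exists]
  constructor
  · rintro ⟨z, hz, rfl⟩
    simpa [hx] using hz
  · intro h
    exact ⟨_, h, by simp [hx]⟩

/-- The infimum `⋀ S` of a set `S` of semistar operations: `E ↦ ⋂ {E^s | s ∈ S}`. -/
noncomputable def SemistarOp.inf (S : Set (SemistarOp R F)) : SemistarOp R F where
  op E := ⟨⨅ s ∈ S, (s.op E).1, ne_bot_of_le E.2 (le_iInf₂ fun s _ => s.le_op E)⟩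
  op_scale x hx E := by
    ext y
    simp only [mem_scale, Submodule.mem_iInf, SemistarOp.op_scale]
  op_mono E G h := by
    change (⨅ s ∈ S, (s.op E).1) ≤ ⨅ s ∈ S, (s.op G).1
    exact iInf₂_mono fun s _ => s.op_mono E G h
  le_op E := by
    change E.1 ≤ ⨅ s ∈ S, (s.op E).1
    exact le_iInf₂ fun s _ => s.le_op E
  op_op E := by
    apply le_antisymm
    · refine Subtype.mk_le_mk.2 (le_iInf₂ fun s hs => (iInf₂_le s hs).trans ?_)
      have h := s.op_mono ⟨⨅ s ∈ S, (s.op E).1, ne_bot_of_le E.2 (le_iInf₂ fun s _ => s.le_op E)⟩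
        (s.op E) (Subtype.mk_le_mk.2 (iInf₂_le s hs))
      rw [s.op_op] at h
      exact h
    · refine Subtype.mk_le_mk.2 (le_iInf₂ fun s _ => ?_)
      exact s.le_op ⟨⨅ s ∈ S, (s.op E).1, ne_bot_of_le E.2 (le_iInf₂ fun s _ => s.le_op E)⟩

theorem le_mul_overring (E : Submodule R F) (T : Subalgebra R F) :
    E ≤ E * Subalgebra.toSubmodule T := fun x hx => by
  have h1 : (1 : F) ∈ Subalgebra.toSubmodule T := T.one_mem
  simpa using Submodule.mul_mem_mul hx h1

/-- The semistar operation of `R` defined by an overring `T`: `E ↦ ET`. -/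
noncomputable def ofOverring (T : Subalgebra R F) : SemistarOp R F where
  op E := ⟨E.1 * Subalgebra.toSubmodule T, ne_bot_of_le E.2 (le_mul_overring E.1 T)⟩
  op_scale x hx E := Subtype.ext (by
    change (x • E.1) * Subalgebra.toSubmodule T = x • (E.1 * Subalgebra.toSubmodule T)
    exact smul_mul_assoc x E.1 _)
  op_mono E G h := Submodule.mul_le.2 fun _ hm _ hn => Submodule.mul_mem_mul (h hm) hn
  le_op E := le_mul_overring E.1 T
  op_op E := Subtype.ext (by
    change E.1 * Subalgebra.toSubmodule T * Subalgebra.toSubmodule T = _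
    rw [mul_assoc, (Subalgebra.isIdempotentElem_toSubmodule T).eq])

/-- The semistar operation `⋀_𝒯` defined by a set `𝒯` of overrings: `E ↦ ⋂ {ET | T ∈ 𝒯}`. -/
noncomputable def ofOverrings (𝒯 : Set (Subalgebra R F)) : SemistarOp R F :=
  SemistarOp.inf (ofOverring '' 𝒯)

/-- The sum of two nonzero submodules. -/
def Fbar.sup (E G : Fbar R F) : Fbar R F := ⟨E.1 ⊔ G.1, ne_bot_of_le E.2 le_sup_left⟩

theorem Fbar.le_sup_left (E G : Fbar R F) : E ≤ E.sup G :=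
  (_root_.le_sup_left : E.1 ≤ E.1 ⊔ G.1)

theorem Fbar.le_sup_right (E G : Fbar R F) : G ≤ E.sup G :=
  (_root_.le_sup_right : G.1 ≤ E.1 ⊔ G.1)

/-- The submodule generated by a nonzero element. -/
def spanSingle (y : F) (hy : y ≠ 0) : Fbar R F :=
  ⟨Submodule.span R {y}, by simpa using hy⟩

theorem fg_spanSingle (y : F) (hy : y ≠ 0) : (spanSingle (R := R) y hy).1.FG :=
  Submodule.fg_span_singleton y

theorem spanSingle_le {E : Fbar R F} {y : F} (hy : y ≠ 0) (h : y ∈ E.1) :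
    spanSingle y hy ≤ E :=
  (Submodule.span_singleton_le_iff_mem y E.1).2 h

theorem scale_inv_scale {x : F} (hx : x ≠ 0) (E : Fbar R F) :
    (E.scale x hx).scale x⁻¹ (inv_ne_zero hx) = E :=
  Subtype.ext (inv_smul_smul₀ hx E.1)

theorem exists_fg_le_op (s : SemistarOp R F) (E : Fbar R F) (t : Finset F)
    (ht : ∀ x ∈ t, ∃ G : Fbar R F, G.1.FG ∧ G ≤ E ∧ x ∈ (s.op G).1) :
    ∃ G : Fbar R F, G.1.FG ∧ G ≤ E ∧ ∀ x ∈ t, x ∈ (s.op G).1 := by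
  classical
  induction t using Finset.induction_on with
  | empty =>
    obtain ⟨y, hy, hy0⟩ := Submodule.exists_mem_ne_zero_of_ne_bot E.2
    exact ⟨_, fg_spanSingle y hy0, spanSingle_le hy0 hy, by simp⟩
  | insert a t _ ih =>
    obtain ⟨G, hG, hGE, hx⟩ := ih fun x hx => ht x (Finset.mem_insert_of_mem hx)
    obtain ⟨H, hH, hHE, ha⟩ := ht a (Finset.mem_insert_self a t)
    refine ⟨G.sup H, hG.sup hH, sup_le (c := E.1) hGE hHE, fun x hxt => ?_⟩
    rcases Finset.mem_insert.1 hxt with rfl | hxt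
    · exact s.op_mono H (G.sup H) (G.le_sup_right H) ha
    · exact s.op_mono G (G.sup H) (G.le_sup_left H) (hx x hxt)

/-- The semistar operation of finite type associated to `s`:
`E ↦ ⋃ {G^s | G ⊆ E a nonzero finitely generated submodule}`. -/
noncomputable def SemistarOp.finType (s : SemistarOp R F) : SemistarOp R F where
  op E := ⟨{ carrier := {x | ∃ G : Fbar R F, G.1.FG ∧ G ≤ E ∧ x ∈ (s.op G).1}
             zero_mem' := by
               obtain ⟨y, hy, hy0⟩ := Submodule.exists_mem_ne_zero_of_ne_bot E.2
               exact ⟨_, fg_spanSingle y hy0, spanSingle_le hy0 hy, Submodule.zero_mem _⟩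
             add_mem' := by
               rintro x y ⟨G, hG, hGE, hx⟩ ⟨H, hH, hHE, hy⟩
               exact ⟨G.sup H, hG.sup hH, sup_le (c := E.1) hGE hHE,
                 add_mem (s.op_mono G (G.sup H) (G.le_sup_left H) hx)
                   (s.op_mono H (G.sup H) (G.le_sup_right H) hy)⟩
             smul_mem' := by
               rintro c x ⟨G, hG, hGE, hx⟩
               exact ⟨G, hG, hGE, Submodule.smul_mem _ c hx⟩ },
    ne_bot_of_le E.2 fun y hy => by
      by_cases hy0 : y = 0
      · rw [hy0]
        exact Submodule.zero_mem _
      · exact ⟨_, fg_spanSingle y hy0, spanSingle_le hy0 hy,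
          s.le_op _ (Submodule.mem_span_singleton_self y)⟩⟩
  op_scale x hx E := by
    have key : ∀ (x : F) (hx : x ≠ 0) (E : Fbar R F) (y : F),
        (∃ G : Fbar R F, G.1.FG ∧ G ≤ E ∧ y ∈ (s.op G).1) →
        ∃ G : Fbar R F, G.1.FG ∧ G ≤ E.scale x hx ∧ x * y ∈ (s.op G).1 := by
      rintro x hx E y ⟨G, hG, hGE, hy⟩
      refine ⟨G.scale x hx, hG.map _, fun z hz => ?_, ?_⟩
      · rw [mem_scale] at hz ⊢
        exact hGE hz
      · rw [s.op_scale, mem_scale, inv_mul_cancel_left₀ hx]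
        exact hy
    ext y
    rw [mem_scale]
    constructor
    · intro h
      have h' := key x⁻¹ (inv_ne_zero hx) _ y h
      rwa [scale_inv_scale] at h'
    · intro h
      have h' := key x hx _ _ h
      rwa [mul_inv_cancel_left₀ hx] at h'
  op_mono E G h := by
    rintro x ⟨H, hH, hHE, hx⟩
    exact ⟨H, hH, hHE.trans h, hx⟩
  le_op E := fun y hy => by
    by_cases hy0 : y = 0
    · rw [hy0]
      exact Submodule.zero_mem _
    · exact ⟨_, fg_spanSingle y hy0, spanSingle_le hy0 hy,
        s.le_op _ (Submodule.mem_span_singleton_self y)⟩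
  op_op E := by
    ext y
    constructor
    · rintro ⟨G, ⟨t, ht⟩, hGE, hy⟩
      obtain ⟨H, hH, hHE, h⟩ := exists_fg_le_op s E t fun x hx =>
        hGE (by rw [← ht]; exact Submodule.subset_span hx)
      refine ⟨H, hH, hHE, ?_⟩
      rw [← s.op_op H]
      refine s.op_mono G (s.op H) ?_ hy
      change G.1 ≤ _
      rw [← ht]
      exact Submodule.span_le.2 h
    · rintro ⟨G, hG, hGE, hy⟩
      refine ⟨G, hG, fun z hz => ?_, hy⟩
      exact ⟨G, hG, hGE, s.le_op _ hz⟩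

/-- The ideal `I` of `R`, regarded as an `R`-submodule of `F`. -/
def idealSub (I : Ideal R) (hI : I ≠ ⊥) : Fbar R F :=
  ⟨IsLocalization.coeSubmodule F I, fun h => hI
    (IsFractionRing.coeSubmodule_injective R F (h.trans (IsLocalization.coeSubmodule_bot F).symm))⟩

/-- `I` is a quasi-`s`-ideal: a nonzero ideal with `I^s ∩ R = I`. -/
def SemistarOp.IsQuasiIdeal (s : SemistarOp R F) (I : Ideal R) : Prop :=
  ∃ hI : I ≠ ⊥, ∀ r : R, algebraMap R F r ∈ (s.op (idealSub I hI)).1 ↔ r ∈ I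

/-- The set of quasi-`s`-maximal ideals: the maximal elements of the set of all proper
quasi-`s`-ideals. -/
def SemistarOp.QMax (s : SemistarOp R F) : Set (Ideal R) :=
  {Q | Maximal (fun I => s.IsQuasiIdeal I ∧ I ≠ ⊤) Q}

theorem mem_idealSub {I : Ideal R} {hI : I ≠ ⊥} {r : R} :
    algebraMap R F r ∈ (idealSub I hI).1 ↔ r ∈ I := by
  change algebraMap R F r ∈ IsLocalization.coeSubmodule F I ↔ _
  rw [IsLocalization.mem_coeSubmodule]
  constructor
  · rintro ⟨z, hz, h⟩
    rwa [← IsFractionRing.injective R F h]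
  · exact fun h => ⟨r, h, rfl⟩

/-- Quasi-maximal ideals are prime. -/
theorem SemistarOp.isPrime_of_mem_QMax (s : SemistarOp R F) {Q : Ideal R} (hQ : Q ∈ s.QMax) :
    Q.IsPrime := by
  obtain ⟨⟨⟨hQ0, hQs⟩, hQ1⟩, hmax⟩ := hQ
  refine ⟨hQ1, fun {a b} hab => ?_⟩
  by_contra! hcon
  obtain ⟨ha, hb⟩ := hcon
  have hJ0 : Q ⊔ Ideal.span {a} ≠ ⊥ := fun h => hQ0 (le_bot_iff.1 (h ▸ le_sup_left))
  set J : Fbar R F := idealSub (Q ⊔ Ideal.span {a}) hJ0 with hJ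
  let I : Ideal R := (s.op J).1.comap (Algebra.linearMap R F)
  have hmemI : ∀ r, r ∈ I ↔ algebraMap R F r ∈ (s.op J).1 := fun r => Iff.rfl
  have hle : Q ⊔ Ideal.span {a} ≤ I := fun r hr => s.le_op J (mem_idealSub.2 hr)
  have hI0 : I ≠ ⊥ := fun h => hJ0 (le_bot_iff.1 (h ▸ hle))
  have hIq : s.IsQuasiIdeal I := by
    refine ⟨hI0, fun r => ⟨fun hr => ?_, fun hr => s.le_op _ (mem_idealSub.2 hr)⟩⟩
    rw [hmemI, ← s.op_op]
    refine s.op_mono (idealSub I hI0) (s.op J) ?_ hr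
    rintro _ ⟨z, hz, rfl⟩
    exact hz
  have haI : a ∈ I := hle (Ideal.mem_sup_right (Ideal.mem_span_singleton_self a))
  have hI1 : I = ⊤ := by
    by_contra h
    exact ha (hmax ⟨hIq, h⟩ (le_sup_left.trans hle) haI)
  have hb0 : algebraMap R F b ≠ 0 := by
    intro h
    exact hb ((IsFractionRing.injective R F (h.trans (map_zero _).symm)) ▸ Q.zero_mem)
  refine hb ((hQs b).1 ?_)
  have h1 : (1 : F) ∈ (s.op J).1 := by
    have : (1 : R) ∈ I := hI1 ▸ Submodule.mem_top
    simpa [hmemI] using this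
  have h2 : algebraMap R F b ∈ (s.op (J.scale _ hb0)).1 := by
    rw [s.op_scale, mem_scale, inv_mul_cancel₀ hb0]
    exact h1
  refine s.op_mono _ (idealSub Q hQ0) ?_ h2
  intro y hy
  have hy' := (mem_scale hb0).1 hy
  obtain ⟨z, hz, hzy⟩ := hy'
  have hyz : y = algebraMap R F (b * z) := by
    rw [map_mul, ← Algebra.linearMap_apply (R := R) (A := F) z, hzy, mul_inv_cancel_left₀ hb0]
  rw [hyz, mem_idealSub]
  obtain ⟨q, hq, w, hw, rfl⟩ := Submodule.mem_sup.1 hz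
  obtain ⟨c, rfl⟩ := Ideal.mem_span_singleton'.1 hw
  have : b * (q + c * a) = b * q + c * (a * b) := by ring
  rw [this]
  exact Q.add_mem (Q.mul_mem_left _ hq) (Q.mul_mem_left _ hab)

variable (F) in
/-- The localization `R_P`, as an overring of `R` inside `F`. -/
noncomputable def locAt (P : Ideal R) (hP : P.IsPrime) : Subalgebra R F :=
  haveI := hP
  Localization.subalgebra.ofField F P.primeCompl P.primeCompl_le_nonZeroDivisors

/-- The family of overrings `{R_Q | Q ∈ QMax^{s_f}(R)}`. -/
def SemistarOp.locFamily (s : SemistarOp R F) : Set (Subalgebra R F) :=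
  {T | ∃ (Q : Ideal R) (hQ : Q ∈ s.finType.QMax),
    T = locAt F Q (s.finType.isPrime_of_mem_QMax hQ)}

/-- The stable semistar operation of finite type associated to `s`:
`E ↦ ⋂ {E R_Q | Q ∈ QMax^{s_f}(R)}` (the empty intersection being `F`). -/
noncomputable def SemistarOp.tilde (s : SemistarOp R F) : SemistarOp R F :=
  ofOverrings s.locFamily

end General

section Polynomial

variable {D K : Type*} [CommRing D] [IsDomain D] [Field K] [Algebra D K] [IsFractionRing D K]

/-- `D[X]` maps to `K(X)` through `K[X]`. -/
noncomputable instance (priority := low) algebraPolyRatFunc : Algebra D[X] (RatFunc K) :=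
  ((algebraMap K[X] (RatFunc K)).comp (mapRingHom (algebraMap D K))).toAlgebra

theorem algebraMap_polyRatFunc (p : D[X]) :
    algebraMap D[X] (RatFunc K) p = algebraMap K[X] (RatFunc K) (p.map (algebraMap D K)) := rfl

/-- `K(X)` is the quotient field of `D[X]`. -/
instance : IsFractionRing D[X] (RatFunc K) := by
  have hinj : Function.Injective (algebraMap D K) := IsFractionRing.injective D K
  have : FaithfulSMul D[X] (RatFunc K) := by
    rw [faithfulSMul_iff_algebraMap_injective]
    exact (RatFunc.algebraMap_injective K).comp (map_injective _ hinj)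
  have key : ∀ p : K[X], ∃ (d : D) (q : D[X]), d ≠ 0 ∧
      q.map (algebraMap D K) = C (algebraMap D K d) * p := by
    intro p
    obtain ⟨d, hd, h⟩ := IsLocalization.integerNormalization_spec (nonZeroDivisors D) p
    refine ⟨d, _, nonZeroDivisors.ne_zero hd, h.trans ?_⟩
    ext n
    simp [Algebra.smul_def]
  refine IsFractionRing.of_field D[X] (RatFunc K) fun z => ?_
  obtain ⟨p, q, hq, rfl⟩ := IsFractionRing.div_surjective (A := K[X]) z
  obtain ⟨d, p', hd, hp⟩ := key p
  obtain ⟨e, q', he, hq'⟩ := key q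
  have hC : ∀ {c : D}, c ≠ 0 → algebraMap K[X] (RatFunc K) (C (algebraMap D K c)) ≠ 0 := by
    intro c hc
    refine RatFunc.algebraMap_ne_zero ?_
    rw [Ne, C_eq_zero, map_eq_zero_iff _ hinj]
    exact hc
  have hq0 : algebraMap K[X] (RatFunc K) q ≠ 0 :=
    RatFunc.algebraMap_ne_zero (nonZeroDivisors.ne_zero hq)
  refine ⟨C e * p', C d * q', ?_⟩
  rw [algebraMap_polyRatFunc, algebraMap_polyRatFunc, Polynomial.map_mul, Polynomial.map_mul, hp,
    hq', map_C, map_C]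
  simp only [map_mul]
  have := hC hd
  have := hC he
  field_simp

/-- The `D[X]`-submodule `E[X]` of `K(X)`: polynomials with all coefficients in `E`. -/
noncomputable def polyExt (E : Submodule D K) : Submodule D[X] (RatFunc K) where
  carrier := {f | ∃ p : K[X], (∀ n, p.coeff n ∈ E) ∧ algebraMap K[X] (RatFunc K) p = f}
  zero_mem' := ⟨0, by simp, by simp⟩
  add_mem' := by
    rintro _ _ ⟨p, hp, rfl⟩ ⟨q, hq, rfl⟩
    exact ⟨p + q, fun n => by simpa using E.add_mem (hp n) (hq n), by simp⟩
  smul_mem' := by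
    rintro c _ ⟨p, hp, rfl⟩
    refine ⟨c.map (algebraMap D K) * p, fun n => ?_, ?_⟩
    · rw [coeff_mul]
      refine E.sum_mem fun i _ => ?_
      rw [coeff_map, ← Algebra.smul_def]
      exact E.smul_mem _ (hp _)
    · rw [Algebra.smul_def, algebraMap_polyRatFunc, map_mul]

theorem polyExt_ne_bot {E : Submodule D K} (hE : E ≠ ⊥) : polyExt E ≠ ⊥ := by
  obtain ⟨y, hy, hy0⟩ := Submodule.exists_mem_ne_zero_of_ne_bot hE
  refine (Submodule.ne_bot_iff _).2 ⟨algebraMap K[X] (RatFunc K) (C y), ⟨C y, fun n => ?_, rfl⟩,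
    RatFunc.algebraMap_ne_zero (C_ne_zero.2 hy0)⟩
  rw [coeff_C]
  split_ifs
  exacts [hy, E.zero_mem]

/-- `E[X]` as a nonzero `D[X]`-submodule of `K(X)`. -/
noncomputable def Fbar.poly (E : Fbar D K) : Fbar D[X] (RatFunc K) :=
  ⟨polyExt E.1, polyExt_ne_bot E.2⟩

/-- The overring `T[X]` of `D[X]`, for an overring `T` of `D`. -/
noncomputable def polyOverring (T : Subalgebra D K) : Subalgebra D[X] (RatFunc K) where
  carrier := polyExt (Subalgebra.toSubmodule T)
  mul_mem' := by
    rintro _ _ ⟨p, hp, rfl⟩ ⟨q, hq, rfl⟩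
    refine ⟨p * q, fun n => ?_, by simp⟩
    rw [coeff_mul]
    exact Submodule.sum_mem _ fun i _ => T.mul_mem (hp _) (hq _)
  add_mem' := (polyExt (Subalgebra.toSubmodule T)).add_mem
  algebraMap_mem' c := ⟨c.map (algebraMap D K), fun n => by
    rw [coeff_map]; exact T.algebraMap_mem _, rfl⟩

/-- `S` is an extension of `s` to `D[X]`: `E^s = E[X]^S ∩ K` for all `E`. -/
def SemistarOp.IsExtension (S : SemistarOp D[X] (RatFunc K)) (s : SemistarOp D K) : Prop :=
  ∀ (E : Fbar D K) (x : K), x ∈ (s.op E).1 ↔ RatFunc.C x ∈ (S.op E.poly).1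

/-- `S` is a strict extension of `s` to `D[X]`: `E^s[X] = E[X]^S` for all `E`. -/
def SemistarOp.IsStrictExtension (S : SemistarOp D[X] (RatFunc K)) (s : SemistarOp D K) : Prop :=
  ∀ E : Fbar D K, (s.op E).poly = S.op E.poly

/-- The infimum `⋏^s` of all semistar operations of `D[X]` extending `s`. -/
noncomputable def SemistarOp.curlywedge (s : SemistarOp D K) : SemistarOp D[X] (RatFunc K) :=
  SemistarOp.inf {S | S.IsExtension s}

/-- The semistar operation `[s~]` of `D[X]`, where `s~` is `s.tilde`:
`A ↦ ⋂ {A D_Q[X] | Q ∈ QMax^{s_f}(D)}` (the empty intersection being `K(X)`). -/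
noncomputable def SemistarOp.bracketTilde (s : SemistarOp D K) : SemistarOp D[X] (RatFunc K) :=
  ofOverrings (polyOverring '' s.locFamily)

end Polynomial

end Semistar

namespace Semistar

/-! ### Families of localizations as semistar operations -/

section General

variable {R F : Type*} [CommRing R] [IsDomain R] [Field F] [Algebra R F] [IsFractionRing R F]

/-! Let `Ps` be a nonempty set of primes P of D. The operation A ↦ ⋂ A D_P[X] is a strict extension
of E ↦ ⋂ E D_P, because E[X] D_P[X] = (E D_P)[X] and coefficientwise conditions commute with
intersections (`ofOverrings_isStrictExtension`). It also lies below every extension S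
(`ofOverrings_le_of_isExtension`). If f ∈ A D_P[X] for all P, clearing denominators shows that the
ideal I = {d : df ∈ A} lies in no P. Hence 1 is in the closure of I, so 1 ∈ (I[X])^S, and f ∈ (f
I[X])^S ⊆ A^S. So it is the infimum of all extensions, and the least strict one. If there are no
quasi-maximal ideals, the same argument runs with `Ps` = {0}, since D_0 = K. -/

theorem mem_inf {S : Set (SemistarOp R F)} {E : Fbar R F} {x : F} :
    x ∈ ((SemistarOp.inf S).op E).1 ↔ ∀ s ∈ S, x ∈ (s.op E).1 := by
  change x ∈ (⨅ s ∈ S, (s.op E).1) ↔ _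
  simp only [Submodule.mem_iInf]

theorem mem_ofOverrings {𝒯 : Set (Subalgebra R F)} {E : Fbar R F} {x : F} :
    x ∈ ((ofOverrings 𝒯).op E).1 ↔ ∀ T ∈ 𝒯, x ∈ E.1 * Subalgebra.toSubmodule T := by
  rw [ofOverrings, mem_inf, Set.forall_mem_image]
  rfl

theorem SemistarOp.inf_le {S : Set (SemistarOp R F)} {s : SemistarOp R F} (hs : s ∈ S) :
    SemistarOp.inf S ≤ s := fun _ _ hx => mem_inf.1 hx s hs

theorem SemistarOp.le_inf {S : Set (SemistarOp R F)} {t : SemistarOp R F}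
    (h : ∀ s ∈ S, t ≤ s) : t ≤ SemistarOp.inf S :=
  fun E _ hx => mem_inf.2 fun s hs => h s hs E hx

theorem mem_locAt {P : Ideal R} {hP : P.IsPrime} {x : F} :
    x ∈ locAt F P hP ↔ ∃ d ∉ P, ∃ r : R, algebraMap R F d * x = algebraMap R F r := by
  have := hP
  have hne : ∀ {d : R}, d ∉ P → algebraMap R F d ≠ 0 := fun {d} hd h =>
    hd ((IsFractionRing.injective R F (h.trans (map_zero _).symm)) ▸ P.zero_mem)
  change x ∈ Localization.subalgebra.ofField F P.primeCompl P.primeCompl_le_nonZeroDivisors ↔ _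
  change (∃ (a d : R) (_ : d ∈ P.primeCompl), x = algebraMap R F a * (algebraMap R F d)⁻¹) ↔ _
  constructor
  · rintro ⟨a, s, hs, rfl⟩
    exact ⟨s, hs, a, by have := hne hs; field_simp⟩
  · rintro ⟨d, hd, r, h⟩
    exact ⟨r, d, hd, by have := hne hd; field_simp; rw [mul_comm, h]⟩

theorem locAt_bot : locAt F (⊥ : Ideal R) Ideal.isPrime_bot = ⊤ := by
  refine eq_top_iff.2 fun x _ => mem_locAt.2 ?_
  obtain ⟨a, b, hb, rfl⟩ := IsFractionRing.div_surjective (A := R) x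
  have hb0 : algebraMap R F b ≠ 0 := IsFractionRing.to_map_ne_zero_of_mem_nonZeroDivisors hb
  exact ⟨b, nonZeroDivisors.ne_zero hb, a, by field_simp⟩

theorem mul_top_eq_top (E : Fbar R F) :
    E.1 * Subalgebra.toSubmodule (⊤ : Subalgebra R F) = ⊤ := by
  obtain ⟨y, hy, hy0⟩ := Submodule.exists_mem_ne_zero_of_ne_bot E.2
  refine eq_top_iff.2 fun x _ => ?_
  rw [← mul_inv_cancel_left₀ hy0 x]
  exact Submodule.mul_mem_mul hy (Algebra.mem_top (R := R))

/-- Both sides send every E to F. On D[X] the two families differ: the empty one gives K(X), while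
{K} gives A K[X]. The singleton is the one that yields a strict extension. -/
theorem ofOverrings_empty : ofOverrings (∅ : Set (Subalgebra R F)) = ofOverrings {⊤} := by
  ext E x
  rw [mem_ofOverrings, mem_ofOverrings]
  simp only [Set.mem_empty_iff_false, false_imp_iff, implies_true, Set.mem_singleton_iff,
    forall_eq, mul_top_eq_top, Submodule.mem_top]

/-- The family of overrings `{R_P | P ∈ Ps}`, for a set `Ps` of primes. -/
def locFamilyOf (F : Type*) [Field F] [Algebra R F] [IsFractionRing R F]
    (Ps : Set (PrimeSpectrum R)) : Set (Subalgebra R F) :=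
  (fun P : PrimeSpectrum R => locAt F P.asIdeal P.isPrime) '' Ps

theorem SemistarOp.locFamily_eq (s : SemistarOp R F) :
    s.locFamily = locFamilyOf F {P | P.asIdeal ∈ s.finType.QMax} := by
  ext T
  constructor
  · rintro ⟨Q, hQ, rfl⟩
    exact ⟨⟨Q, s.finType.isPrime_of_mem_QMax hQ⟩, hQ, rfl⟩
  · rintro ⟨P, hP, rfl⟩
    exact ⟨P.asIdeal, hP, rfl⟩

theorem SemistarOp.tilde_eq_of_QMax_empty (s : SemistarOp R F) (h : s.finType.QMax = ∅) :
    s.tilde = ofOverrings (locFamilyOf F {(⊥ : PrimeSpectrum R)}) := by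
  rw [SemistarOp.tilde, s.locFamily_eq, h]
  simp only [Set.mem_empty_iff_false, Set.ofPred_false, locFamilyOf, Set.image_empty,
    Set.image_singleton]
  rw [ofOverrings_empty, ← locAt_bot]
  rfl

/-- An ideal that meets the complement of every prime of `Ps` is dense for the operation
defined by the localizations at `Ps`. -/
theorem one_mem_ofOverrings_idealSub {Ps : Set (PrimeSpectrum R)} {I : Ideal R} (hI : I ≠ ⊥)
    (h : ∀ P ∈ Ps, ∃ d ∈ I, d ∉ P.asIdeal) :
    (1 : F) ∈ ((ofOverrings (locFamilyOf F Ps)).op (idealSub I hI)).1 := by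
  refine mem_ofOverrings.2 ?_
  rintro _ ⟨P, hP, rfl⟩
  obtain ⟨d, hdI, hdP⟩ := h P hP
  have hd0 : algebraMap R F d ≠ 0 := fun h0 =>
    hdP ((IsFractionRing.injective R F (h0.trans (map_zero _).symm)) ▸ P.asIdeal.zero_mem)
  -- 1 = d · d⁻¹ with d ∈ I and d⁻¹ ∈ R_P.
  rw [← mul_inv_cancel₀ hd0]
  refine Submodule.mul_mem_mul (mem_idealSub.2 hdI) ?_
  exact mem_locAt.2 ⟨d, hdP, 1, by simp [hd0]⟩

end General

/-! ### Extensions to the polynomial ring -/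

section Polynomial

variable {D K : Type*} [CommRing D] [IsDomain D] [Field K] [Algebra D K] [IsFractionRing D K]

theorem algebraMap_mem_polyExt {E : Submodule D K} {p : K[X]} :
    algebraMap K[X] (RatFunc K) p ∈ polyExt E ↔ ∀ n, p.coeff n ∈ E := by
  constructor
  · rintro ⟨q, hq, h⟩
    rwa [← RatFunc.algebraMap_injective K h]
  · exact fun h => ⟨p, h, rfl⟩

theorem mem_polyOverring {T : Subalgebra D K} {f : RatFunc K} :
    f ∈ polyOverring T ↔ f ∈ polyExt (Subalgebra.toSubmodule T) := Iff.rfl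

theorem monomial_mem_polyExt {E : Submodule D K} {x : K} (hx : x ∈ E) (n : ℕ) :
    algebraMap K[X] (RatFunc K) (monomial n x) ∈ polyExt E := by
  refine algebraMap_mem_polyExt.2 fun m => ?_
  rw [coeff_monomial]
  split_ifs
  exacts [hx, E.zero_mem]

theorem C_mem_polyExt {E : Submodule D K} {x : K} : RatFunc.C x ∈ polyExt E ↔ x ∈ E := by
  rw [← RatFunc.algebraMap_C]
  refine ⟨fun h => ?_, fun h => monomial_mem_polyExt h 0⟩
  simpa using algebraMap_mem_polyExt.1 h 0

/-- `E[X] T[X] = (ET)[X]`. -/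
theorem polyExt_mul_polyOverring (E : Submodule D K) (T : Subalgebra D K) :
    polyExt E * Subalgebra.toSubmodule (polyOverring T) =
      polyExt (E * Subalgebra.toSubmodule T) := by
  apply le_antisymm
  · refine Submodule.mul_le.2 ?_
    rintro _ ⟨p, hp, rfl⟩ _ ⟨q, hq, rfl⟩
    rw [← map_mul]
    refine algebraMap_mem_polyExt.2 fun n => ?_
    rw [coeff_mul]
    exact Submodule.sum_mem _ fun i _ => Submodule.mul_mem_mul (hp _) (hq _)
  · rintro _ ⟨p, hp, rfl⟩
    rw [p.as_sum_support, map_sum]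
    refine Submodule.sum_mem _ fun n _ => ?_
    refine Submodule.mul_induction_on (hp n) (fun e he t ht => ?_) fun x y hx hy => ?_
    -- (et)Xⁿ = (eXⁿ) · t, with t as a constant polynomial.
    · rw [← add_zero n, ← monomial_mul_monomial, map_mul]
      exact Submodule.mul_mem_mul (monomial_mem_polyExt he n)
        (mem_polyOverring.2 (monomial_mem_polyExt ht 0))
    · rw [map_add, map_add]
      exact add_mem hx hy

/-- A nonempty family of overrings `T` gives a strict extension by means of the `T[X]`. -/
theorem ofOverrings_isStrictExtension {𝒯 : Set (Subalgebra D K)} (h𝒯 : 𝒯.Nonempty) :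
    (ofOverrings (polyOverring '' 𝒯)).IsStrictExtension (ofOverrings 𝒯) := by
  intro E
  have key : ∀ f, f ∈ ((ofOverrings (polyOverring '' 𝒯)).op E.poly).1 ↔
      ∀ T ∈ 𝒯, f ∈ polyExt (E.1 * Subalgebra.toSubmodule T) := fun f => by
    rw [mem_ofOverrings, Set.forall_mem_image]
    refine forall₂_congr fun T _ => ?_
    rw [← polyExt_mul_polyOverring]
    rfl
  ext f
  rw [key]
  constructor
  · rintro ⟨p, hp, rfl⟩ T hT
    exact algebraMap_mem_polyExt.2 fun n => mem_ofOverrings.1 (hp n) T hT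
  · intro h
    -- A single member of the family already forces f to be a polynomial; its coefficients can then
    -- be tested against every T.
    obtain ⟨T₀, hT₀⟩ := h𝒯
    obtain ⟨p, -, rfl⟩ := h T₀ hT₀
    exact algebraMap_mem_polyExt.2 fun n =>
      mem_ofOverrings.2 fun T hT => algebraMap_mem_polyExt.1 (h T hT) n

theorem SemistarOp.IsStrictExtension.isExtension {S : SemistarOp D[X] (RatFunc K)}
    {s : SemistarOp D K} (h : S.IsStrictExtension s) : S.IsExtension s := fun E x => by
  rw [← h E]
  exact C_mem_polyExt.symm

/-- Polynomials over `D_P` have a common denominator outside `P`. -/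
theorem exists_C_smul_mem {P : Ideal D} {hP : P.IsPrime} {A : Submodule D[X] (RatFunc K)}
    {f : RatFunc K} (hf : f ∈ A * Subalgebra.toSubmodule (polyOverring (locAt K P hP))) :
    ∃ d ∉ P, (C d : D[X]) • f ∈ A := by
  have hadd : ∀ x y : RatFunc K, (∃ d ∉ P, (C d : D[X]) • x ∈ A) →
      (∃ d ∉ P, (C d : D[X]) • y ∈ A) → ∃ d ∉ P, (C d : D[X]) • (x + y) ∈ A := by
    rintro x y ⟨d, hd, hx⟩ ⟨e, he, hy⟩
    refine ⟨d * e, fun h => (hP.mem_or_mem h).elim hd he, ?_⟩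
    rw [smul_add]
    refine A.add_mem ?_ ?_
    · rw [mul_comm, C_mul, mul_smul]
      exact A.smul_mem _ hx
    · rw [C_mul, mul_smul]
      exact A.smul_mem _ hy
  refine Submodule.mul_induction_on hf (fun a ha g hg => ?_) hadd
  obtain ⟨p, hp, rfl⟩ := hg
  rw [p.as_sum_support, map_sum, Finset.mul_sum]
  refine Finset.sum_induction _ (fun x => ∃ d ∉ P, (C d : D[X]) • x ∈ A) hadd
    ⟨1, fun h => hP.ne_top ((Ideal.eq_top_iff_one P).2 h), by simp⟩ fun n _ => ?_
  obtain ⟨d, hd, r, hr⟩ := mem_locAt.1 (hp n)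
  refine ⟨d, hd, ?_⟩
  -- With the coefficient equal to r/d, multiplying by d leaves rXⁿ ∈ D[X] acting on a.
  have : (C d : D[X]) • (a * algebraMap K[X] (RatFunc K) (monomial n (p.coeff n))) =
      (monomial n r : D[X]) • a := by
    rw [Algebra.smul_def, Algebra.smul_def, algebraMap_polyRatFunc, algebraMap_polyRatFunc,
      map_C, map_monomial, ← hr, ← C_mul_monomial, map_mul]
    ring
  rw [this]
  exact A.smul_mem _ ha

/-- The operation `A ↦ ⋂ A D_P[X]` lies below every extension of `E ↦ ⋂ E D_P`. -/
theorem ofOverrings_le_of_isExtension {Ps : Set (PrimeSpectrum D)} (hPs : Ps.Nonempty)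
    {S : SemistarOp D[X] (RatFunc K)} (hS : S.IsExtension (ofOverrings (locFamilyOf K Ps))) :
    ofOverrings (polyOverring '' locFamilyOf K Ps) ≤ S := by
  intro A f hf
  rw [mem_ofOverrings, Set.forall_mem_image, locFamilyOf, Set.forall_mem_image] at hf
  -- Scaling by f below requires f ≠ 0.
  by_cases hf0 : f = 0
  · rw [hf0]
    exact Submodule.zero_mem _
  -- The conductor of f into A, contracted to D.
  let I : Ideal D := Ideal.comap (C : D →+* D[X])
    (A.1.comap (LinearMap.toSpanSingleton D[X] (RatFunc K) f))
  have hmem : ∀ d, d ∈ I ↔ (C d : D[X]) • f ∈ A.1 := fun d => Iff.rfl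
  have hI : ∀ P ∈ Ps, ∃ d ∈ I, d ∉ P.asIdeal := fun P hP => by
    obtain ⟨d, hd, h⟩ := exists_C_smul_mem (hf hP)
    exact ⟨d, h, hd⟩
  -- Nonemptiness of `Ps` matters here: semistar operations act only on nonzero modules.
  have hI0 : I ≠ ⊥ := by
    obtain ⟨P, hP⟩ := hPs
    obtain ⟨d, hd, hdP⟩ := hI P hP
    rintro h
    rw [h, Ideal.mem_bot] at hd
    exact hdP (hd ▸ P.asIdeal.zero_mem)
  -- The extension hypothesis is needed only for the module I and the element 1.
  have h1 := (hS _ 1).1 (one_mem_ofOverrings_idealSub (F := K) hI0 hI)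
  have h2 : f ∈ (S.op ((idealSub I hI0).poly.scale f hf0)).1 := by
    rw [S.op_scale, mem_scale, inv_mul_cancel₀ hf0]
    simpa using h1
  -- The remaining inclusion f I[X] ⊆ A is checked on monomials: f · dXⁿ = Xⁿ(df) with d ∈ I.
  refine S.op_mono _ A (fun y hy => ?_) h2
  obtain ⟨p, hp, h⟩ := (mem_scale hf0).1 hy
  rw [← mul_inv_cancel_left₀ hf0 y, ← h, p.as_sum_support, map_sum, Finset.mul_sum]
  refine Submodule.sum_mem _ fun n _ => ?_
  obtain ⟨d, hd, hdn⟩ := hp n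
  have : f * algebraMap K[X] (RatFunc K) (monomial n (p.coeff n)) =
      (X ^ n : D[X]) • (C d : D[X]) • f := by
    rw [← hdn, Algebra.linearMap_apply, ← mul_smul, mul_comm (X ^ n) (C d),
      C_mul_X_pow_eq_monomial, Algebra.smul_def, algebraMap_polyRatFunc, map_monomial, mul_comm]
  rw [this]
  exact A.1.smul_mem _ ((hmem d).1 hd)

theorem curlywedge_ofOverrings {Ps : Set (PrimeSpectrum D)} (hPs : Ps.Nonempty) :
    (ofOverrings (locFamilyOf K Ps)).curlywedge =
      ofOverrings (polyOverring '' locFamilyOf K Ps) :=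
  le_antisymm
    (SemistarOp.inf_le (ofOverrings_isStrictExtension (hPs.image _)).isExtension)
    (SemistarOp.le_inf fun _ hS => ofOverrings_le_of_isExtension hPs hS)

/-- Strict extensions are extensions, so the infimum of all extensions bounds them from below; its
explicit form shows that it is itself strict. -/
theorem isLeast_curlywedge_ofOverrings {Ps : Set (PrimeSpectrum D)} (hPs : Ps.Nonempty) :
    IsLeast {S : SemistarOp D[X] (RatFunc K) |
      S.IsStrictExtension (ofOverrings (locFamilyOf K Ps))}
      (ofOverrings (locFamilyOf K Ps)).curlywedge := by
  refine ⟨?_, fun S hS => SemistarOp.inf_le (SemistarOp.IsStrictExtension.isExtension hS)⟩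
  rw [curlywedge_ofOverrings hPs]
  exact ofOverrings_isStrictExtension (hPs.image _)

end Polynomial

end Semistar

/-! ### The theorem, with the empty case as the family {0} -/

theorem mainTheorem4 {D K : Type*} [CommRing D] [IsDomain D] [Field K] [Algebra D K]
    [IsFractionRing D K] (s : Semistar.SemistarOp D K) :
    IsLeast {S : Semistar.SemistarOp D[X] (RatFunc K) | S.IsStrictExtension s.tilde}
      s.tilde.curlywedge ∧
    (s.finType.QMax.Nonempty →
      s.tilde.curlywedge = s.bracketTilde ∧
      ∀ A : Semistar.Fbar D[X] (RatFunc K),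
        (s.tilde.curlywedge.op A).1 =
          ⨅ (Q : Ideal D) (hQ : Q ∈ s.finType.QMax), A.1 * Subalgebra.toSubmodule
            (Semistar.polyOverring
              (Semistar.locAt K Q (s.finType.isPrime_of_mem_QMax hQ)))) ∧
    (s.finType.QMax = ∅ →
      ∀ A : Semistar.Fbar D[X] (RatFunc K),
        (s.tilde.curlywedge.op A).1 =
          A.1 * Subalgebra.toSubmodule (Semistar.polyOverring (⊤ : Subalgebra D K))) := by
  have hne : s.finType.QMax.Nonempty →
      {P : PrimeSpectrum D | P.asIdeal ∈ s.finType.QMax}.Nonempty := fun ⟨Q, hQ⟩ =>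
    ⟨⟨Q, s.finType.isPrime_of_mem_QMax hQ⟩, hQ⟩
  have htilde : s.tilde = Semistar.ofOverrings
      (Semistar.locFamilyOf K {P | P.asIdeal ∈ s.finType.QMax}) := by
    rw [← s.locFamily_eq, Semistar.SemistarOp.tilde]
  refine ⟨?_, fun h => ?_, fun h A => ?_⟩
  · rcases s.finType.QMax.eq_empty_or_nonempty with h | h
    · rw [s.tilde_eq_of_QMax_empty h]
      exact Semistar.isLeast_curlywedge_ofOverrings (Set.singleton_nonempty _)
    · rw [htilde]
      exact Semistar.isLeast_curlywedge_ofOverrings (hne h)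
  · have heq : s.tilde.curlywedge = s.bracketTilde := by
      rw [htilde, Semistar.curlywedge_ofOverrings (hne h), ← s.locFamily_eq,
        Semistar.SemistarOp.bracketTilde]
    refine ⟨heq, fun A => ?_⟩
    ext f
    rw [heq, Semistar.SemistarOp.bracketTilde, Semistar.mem_ofOverrings, Set.forall_mem_image]
    simp only [Submodule.mem_iInf]
    constructor
    · exact fun hf Q hQ => hf ⟨Q, hQ, rfl⟩
    · rintro hf _ ⟨Q, hQ, rfl⟩
      exact hf Q hQ
  · ext f
    rw [s.tilde_eq_of_QMax_empty h, Semistar.curlywedge_ofOverrings (Set.singleton_nonempty _),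
      Semistar.mem_ofOverrings, Semistar.locFamilyOf, Set.image_singleton, Set.image_singleton]
    simp only [Set.mem_singleton_iff, forall_eq]
    rw [← Semistar.locAt_bot]
    rfl
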